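/- Let $n$ be a positive integer and let $G$ be a subgroup of $\mathrm{GL}_{2^n}(\mathbb{C})$ in which every element is similar to a permutation matrix. Suppose that $G$ contains a matrix $C$ that is similar to the permutation matrix of a cycle of length $2^n$ (a maximal cycle), and that the cyclic subgroup $\langle C\rangle$ is normal in $G$. Then there is a single $T\in\mathrm{GL}_{2^n}(\mathbb{C})$ such that $T^{-1}AT$ is a permutation matrix for every $A\in G$; that is, $G$ is a permutation matrix group. -/

import Mathlib

open Matrix

/-- The complex matrix `A` is similar to the permutation matrix of the permutation `σ`:
`T⁻¹ A T` is that matrix for some invertible `T`. -/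
def IsSimilarToPerm {d : ℕ} (A : GL (Fin d) ℂ) (σ : Equiv.Perm (Fin d)) : Prop :=
  ∃ T : GL (Fin d) ℂ, ((T⁻¹ * A * T : GL (Fin d) ℂ) : Matrix (Fin d) (Fin d) ℂ) = σ.permMatrix ℂ

/-- A matrix group is permutation-like if each of its elements is similar to a permutation matrix
(the conjugating matrix may depend on the element). -/
def IsPermutationLike {d : ℕ} (G : Subgroup (GL (Fin d) ℂ)) : Prop :=
  ∀ A ∈ G, ∃ σ : Equiv.Perm (Fin d), IsSimilarToPerm A σ

/-- A matrix group is a permutation matrix group if one invertible matrix conjugates all of its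
elements to permutation matrices. -/
def IsPermutationMatrixGroup {d : ℕ} (G : Subgroup (GL (Fin d) ℂ)) : Prop :=
  ∃ T : GL (Fin d) ℂ, ∀ A ∈ G, ∃ σ : Equiv.Perm (Fin d),
    ((T⁻¹ * A * T : GL (Fin d) ℂ) : Matrix (Fin d) (Fin d) ℂ) = σ.permMatrix ℂ

/-- A `d × d` matrix is a maximal cycle if it is similar to the permutation matrix of a cycle of
length `d`, that is, of a permutation that moves all `d` points in a single cycle. -/
def IsMaximalCycle {d : ℕ} (C : GL (Fin d) ℂ) : Prop :=
  ∃ σ : Equiv.Perm (Fin d), σ.IsCycleOn Set.univ ∧ IsSimilarToPerm C σ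

/-! Put `N = 2 ^ n`. The eigenvalues of `C` are the `N`-th roots of unity, each simple, so `G`
permutes the eigenlines: `A e_i = a A i • e_{κ A * i}`. It suffices to find a vector with all
coordinates nonzero whose `G`-orbit is its `⟨C⟩`-orbit: its `N` translates under `⟨C⟩` form a basis
(Fourier inversion) permuted by `G`.

Such a vector comes from a complement `H` of `⟨C⟩` in which every element acts trivially on each
line it stabilizes; then orbits of lines carry consistent coordinates (`exists_invariant_vector`).
Traces on a coset `A⟨C⟩` are fixed-point counts. Their first two moments force each to be `0` or the
number of stabilized lines, so every coset contains an element of the desired kind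
(`exists_fixesLines`), and powers inherit the property.

It remains to lift the image of `κ` to a subgroup. Subgroups of `(ZMod (2 ^ n))ˣ` are cyclic up to
sign, so the only obstruction is making a lift of `-1` commute with a lift of a generator
(`exists_commuting_fixesLines`). -/

/-! ### Annihilators and units modulo `2 ^ n`. -/

/-- Divisibility in `ZMod N` is detected by annihilators. -/
theorem ZMod.dvd_of_forall_mul_eq_zero {N : ℕ} [NeZero N] {m x : ZMod N}
    (h : ∀ i, m * i = 0 → x * i = 0) : m ∣ x := by
  obtain ⟨m, rfl⟩ := ZMod.intCast_surjective m
  obtain ⟨x, rfl⟩ := ZMod.intCast_surjective x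
  have hN : (N : ℤ) ≠ 0 := by exact_mod_cast NeZero.ne N
  have hg : ((Int.gcd m N : ℕ) : ℤ) ≠ 0 := by
    simp [Int.gcd_eq_zero_iff, NeZero.ne N]
  obtain ⟨m', hm'⟩ := Int.gcd_dvd_left m (N : ℤ)
  obtain ⟨q, hq⟩ := Int.gcd_dvd_right m (N : ℤ)
  generalize hgdef : ((Int.gcd m N : ℕ) : ℤ) = g at *
  have hq0 : q ≠ 0 := by rintro rfl; simp at hq; omega
  -- The test element `q = N / gcd(m, N)` is annihilated by `m`.
  have h1 := h (q : ℤ) (by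
    rw [← Int.cast_mul, ZMod.intCast_zmod_eq_zero_iff_dvd]
    exact ⟨m', by rw [hm', hq]; ring⟩)
  rw [← Int.cast_mul, ZMod.intCast_zmod_eq_zero_iff_dvd] at h1
  have h2 : g ∣ x := by
    rw [hq] at h1
    exact Int.dvd_of_mul_dvd_mul_right hq0 h1
  obtain ⟨w, rfl⟩ := h2
  have h3 : ((g : ℤ) : ZMod N) = (m : ZMod N) * (Int.gcdA m N : ℤ) := by
    have := congrArg (Int.cast : ℤ → ZMod N) (Int.gcd_eq_gcd_ab m N)
    rw [hgdef] at this
    simpa using this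
  exact ⟨(Int.gcdA m N : ℤ) * w, by rw [Int.cast_mul, h3]; ring⟩

/-- `u` is congruent to `1` modulo `4`. -/
def IsOneModFour {N : ℕ} (u : (ZMod N)ˣ) : Prop := ∃ w : ZMod N, (u : ZMod N) = 1 + 4 * w

theorem IsOneModFour.mul {N : ℕ} {u v : (ZMod N)ˣ} (hu : IsOneModFour u) (hv : IsOneModFour v) :
    IsOneModFour (u * v) := by
  obtain ⟨a, ha⟩ := hu
  obtain ⟨b, hb⟩ := hv
  exact ⟨a + b + 4 * a * b, by rw [Units.val_mul, ha, hb]; ring⟩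

theorem IsOneModFour.pow {N : ℕ} {u : (ZMod N)ˣ} (hu : IsOneModFour u) (j : ℕ) :
    IsOneModFour (u ^ j) := by
  induction j with
  | zero => exact ⟨0, by simp⟩
  | succ j ih => rw [pow_succ]; exact ih.mul hu

section TwoPow

variable {n : ℕ}

theorem ZMod.odd_of_unit_two_pow (hn : 0 < n) (u : (ZMod (2 ^ n))ˣ) :
    ∃ w : ZMod (2 ^ n), (u : ZMod (2 ^ n)) = 1 + 2 * w := by
  have h := ZMod.val_coe_unit_coprime u
  have h2 : Odd (u : ZMod (2 ^ n)).val := by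
    rw [← Nat.coprime_two_right]
    exact Nat.Coprime.coprime_dvd_right (dvd_pow_self 2 hn.ne') h
  obtain ⟨w, hw⟩ := h2
  refine ⟨w, ?_⟩
  rw [← ZMod.natCast_zmod_val (u : ZMod (2 ^ n)), hw]
  push_cast; ring

theorem ZMod.isUnit_one_add_two_mul (w : ZMod (2 ^ n)) : IsUnit (1 + 2 * w) := by
  have : IsNilpotent (2 * w) := ⟨n, by
    rw [mul_pow]
    have : ((2 ^ n : ℕ) : ZMod (2 ^ n)) = 0 := ZMod.natCast_self _
    push_cast at this
    rw [this, zero_mul]⟩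
  exact this.isUnit_one_add

theorem ZMod.two_mul_two_pow_pred (hn : 0 < n) : (2 : ZMod (2 ^ n)) * 2 ^ (n - 1) = 0 := by
  have : ((2 ^ n : ℕ) : ZMod (2 ^ n)) = 0 := ZMod.natCast_self _
  rw [← pow_succ', Nat.sub_add_cancel hn]
  exact_mod_cast this

theorem ZMod.eq_zero_or_eq_of_two_mul (hn : 0 < n) {i : ZMod (2 ^ n)} (h : 2 * i = 0) :
    i = 0 ∨ i = 2 ^ (n - 1) := by
  have h1 : ((2 * i.val : ℕ) : ZMod (2 ^ n)) = 0 := by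
    push_cast; rw [ZMod.natCast_zmod_val]; exact h
  rw [ZMod.natCast_eq_zero_iff] at h1
  have h2 : 2 ^ n = 2 * 2 ^ (n - 1) := by rw [← pow_succ', Nat.sub_add_cancel hn]
  have hlt := ZMod.val_lt i
  obtain ⟨q, hq⟩ := h1
  have hi : i.val = 2 ^ (n - 1) * q := by
    have : 2 * i.val = 2 * (2 ^ (n - 1) * q) := by rw [hq]; rw [← mul_assoc, ← h2]
    omega
  have hq2 : q < 2 := by
    by_contra hc
    have : 2 ^ (n - 1) * 2 ≤ 2 ^ (n - 1) * q := Nat.mul_le_mul_left _ (by omega)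
    omega
  rw [← ZMod.natCast_zmod_val i, hi]
  interval_cases q
  · left; simp
  · right; simp

/-- The equation reads `(u + 1) * i = 0`, and `u + 1` is `2` times a unit. -/
theorem IsOneModFour.eq_of_neg_mul_eq (hn : 0 < n) {u : (ZMod (2 ^ n))ˣ} (hu : IsOneModFour u)
    {i : ZMod (2 ^ n)} (h : -(u : ZMod (2 ^ n)) * i = i) : i = 0 ∨ i = 2 ^ (n - 1) := by
  obtain ⟨w, hw⟩ := hu
  apply ZMod.eq_zero_or_eq_of_two_mul hn
  apply (ZMod.isUnit_one_add_two_mul w).mul_right_eq_zero.mp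
  rw [hw] at h
  linear_combination -h

theorem ZMod.unit_mul_two_pow_pred (hn : 0 < n) (u : (ZMod (2 ^ n))ˣ) :
    (u : ZMod (2 ^ n)) * 2 ^ (n - 1) = 2 ^ (n - 1) := by
  obtain ⟨w, hw⟩ := ZMod.odd_of_unit_two_pow hn u
  rw [hw]
  linear_combination w * ZMod.two_mul_two_pow_pred hn

theorem ZMod.isOneModFour_or_neg (hn : 0 < n) (u : (ZMod (2 ^ n))ˣ) :
    IsOneModFour u ∨ IsOneModFour (-u) := by
  obtain ⟨w, hw⟩ := ZMod.odd_of_unit_two_pow hn u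
  rcases Nat.even_or_odd' w.val with ⟨t, ht | ht⟩
  · left
    refine ⟨t, ?_⟩
    rw [hw, ← ZMod.natCast_zmod_val w, ht]
    push_cast; ring
  · right
    refine ⟨-t-1, ?_⟩
    rw [Units.val_neg, hw, ← ZMod.natCast_zmod_val w, ht]
    push_cast; ring

/-- For `n ≥ 2` the powers of `5` have index two, and they miss `-1` because they are all `1` modulo
`4`. -/
theorem ZMod.exists_unit_eq_five_pow (hn : 0 < n) : ∃ f : (ZMod (2 ^ n))ˣ,
    ∀ u : (ZMod (2 ^ n))ˣ, u ∈ Subgroup.zpowers f ∨ -u ∈ Subgroup.zpowers f := by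
  obtain rfl | hn2 : n = 1 ∨ 2 ≤ n := by omega
  · refine ⟨1, fun u => Or.inl ?_⟩
    have : u = 1 := by revert u; decide
    rw [this]; exact one_mem _
  obtain ⟨m, rfl⟩ := Nat.exists_eq_add_of_le' hn2
  have h5 : IsUnit (5 : ZMod (2 ^ (m + 2))) := by
    have := ZMod.isUnit_one_add_two_mul (n := m + 2) 2
    norm_num at this
    exact this
  obtain ⟨f, hf⟩ := h5
  refine ⟨f, ?_⟩
  have hord : Nat.card (Subgroup.zpowers f) = 2 ^ m := by
    rw [Nat.card_zpowers, ← orderOf_units, hf, ZMod.orderOf_five]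
  have hidx : (Subgroup.zpowers f).index = 2 := by
    have h := Subgroup.card_mul_index (Subgroup.zpowers f)
    rw [hord, Nat.card_eq_fintype_card, ZMod.card_units_eq_totient,
      Nat.totient_prime_pow_succ Nat.prime_two] at h
    have : 0 < 2 ^ m := by positivity
    apply Nat.eq_of_mul_eq_mul_left this
    rw [h, pow_succ]; simp
  have hneg : (-1 : (ZMod (2 ^ (m + 2)))ˣ) ∉ Subgroup.zpowers f := by
    intro hc
    rw [mem_zpowers_iff_mem_range_orderOf] at hc
    simp only [Finset.mem_image, Finset.mem_range] at hc
    obtain ⟨j, -, hj⟩ := hc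
    have hf4 : IsOneModFour f := ⟨1, by rw [hf]; norm_num⟩
    obtain ⟨w, hw⟩ := hf4.pow j
    rw [hj] at hw
    have h4 : (4 : ℕ) ∣ 2 ^ (m + 2) := ⟨2 ^ m, by ring⟩
    have := congrArg (ZMod.castHom h4 (ZMod 4)) hw
    simp only [Units.val_neg, Units.val_one, map_neg, map_one, map_add, map_mul, map_ofNat] at this
    generalize (ZMod.castHom h4 (ZMod 4)) w = z at this
    revert z
    decide
  intro u
  by_cases hu : u ∈ Subgroup.zpowers f
  · exact Or.inl hu
  · right
    have := (Subgroup.mul_mem_iff_of_index_two hidx (a := -1) (b := u)).mpr (by tauto)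
    simpa using this

/-- Every subgroup of `(ZMod (2 ^ n))ˣ` is cyclic up to signs. -/
theorem ZMod.exists_generator_up_to_sign (hn : 0 < n) (K : Subgroup (ZMod (2 ^ n))ˣ) :
    ∃ k ∈ K, ∀ x ∈ K, ∃ j : ℤ, x = k ^ j ∨ x = -k ^ j := by
  obtain ⟨f, hf⟩ := ZMod.exists_unit_eq_five_pow hn
  let Z : Subgroup (ZMod (2 ^ n))ˣ := Subgroup.zpowers (-1)
  have hZ : ∀ z, z ∈ Z ↔ z = 1 ∨ z = -1 := by
    intro z
    constructor
    · rintro ⟨j, rfl⟩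
      rcases Int.even_or_odd j with h | h
      · left; exact h.neg_one_zpow
      · right; exact h.neg_one_zpow
    · rintro (rfl | rfl)
      · exact one_mem _
      · exact Subgroup.mem_zpowers _
  -- Modulo `±1` the unit group is cyclic, hence so is the image of `K`; a generator of that image
  -- lifts to `K`.
  have hcyc : IsCyclic ((ZMod (2 ^ n))ˣ ⧸ Z) := by
    refine ⟨(f : (ZMod (2 ^ n))ˣ ⧸ Z), ?_⟩
    intro q
    obtain ⟨u, rfl⟩ := QuotientGroup.mk_surjective q
    rcases hf u with ⟨j, hj⟩ | ⟨j, hj⟩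
    · exact ⟨j, by simp only [← hj]; rfl⟩
    · refine ⟨j, ?_⟩
      change ((f ^ j : (ZMod (2 ^ n))ˣ) : (ZMod (2 ^ n))ˣ ⧸ Z) = u
      rw [QuotientGroup.eq, hZ]
      right
      change f ^ j = -u at hj
      rw [hj]; simp
  obtain ⟨⟨g, hgK⟩, hg⟩ := (Subgroup.isCyclic (K.map (QuotientGroup.mk' Z))).exists_generator
  obtain ⟨k, hk, rfl⟩ := hgK
  refine ⟨k, hk, fun x hx => ?_⟩
  obtain ⟨j, hj⟩ := hg ⟨QuotientGroup.mk' Z x, Subgroup.mem_map_of_mem _ hx⟩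
  refine ⟨j, ?_⟩
  have hj' : ((k ^ j : (ZMod (2 ^ n))ˣ) : (ZMod (2 ^ n))ˣ ⧸ Z) = x := by
    simpa [Subtype.ext_iff] using hj
  rw [QuotientGroup.eq, hZ] at hj'
  rcases hj' with h | h
  · left; exact (inv_mul_eq_one.mp h).symm
  · right; rw [inv_mul_eq_iff_eq_mul] at h; rw [h]; simp

end TwoPow

/-! ### Monomial actions and traces on cosets of `⟨c⟩`. -/

/-- A group `Γ` acting by monomial transformations `A e_i = a A i • e_{κ A * i}` on lines indexed by
`ZMod N`, with a diagonal element `c` having the eigenvalues `stdAddChar i`, such that every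
element has the traces of a permutation. -/
structure MonomialCocycle (N : ℕ) [NeZero N] (Γ : Type*) [Group Γ] where
  κ : Γ →* (ZMod N)ˣ
  a : Γ → ZMod N → ℂ
  a_mul : ∀ A B i, a (A * B) i = a A (κ B * i) * a B i
  a_ne : ∀ A i, a A i ≠ 0
  faithful : ∀ A, κ A = 1 → (∀ i, a A i = 1) → A = 1
  fin : ∀ A : Γ, IsOfFinOrder A
  c : Γ
  κ_c : κ c = 1
  a_c : ∀ i, a c i = ZMod.stdAddChar i
  -- One `σ` must serve all powers of `A`: this is what carries a fixed point from `A` to `A ^ m`.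
  perm : ∀ A, ∃ σ : Equiv.Perm (Fin N), ∀ m : ℕ,
    ∑ i : ZMod N with (κ (A ^ m) : ZMod N) * i = i, a (A ^ m) i = (Function.fixedPoints (σ ^ m)).ncard

namespace MonomialCocycle

variable {N : ℕ} [NeZero N] {Γ : Type*} [Group Γ] (M : MonomialCocycle N Γ)

theorem a_one (i : ZMod N) : M.a 1 i = 1 := by
  have h := M.a_mul 1 1 i
  simp only [mul_one, map_one, Units.val_one, one_mul] at h
  exact (mul_eq_left₀ (M.a_ne 1 i)).mp h.symm

theorem κ_c_pow (m : ℕ) : M.κ (M.c ^ m) = 1 := by rw [map_pow, M.κ_c, one_pow]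

theorem a_c_pow (m : ℕ) (i : ZMod N) : M.a (M.c ^ m) i = ZMod.stdAddChar (m * i : ZMod N) := by
  induction m with
  | zero => simp [M.a_one]
  | succ m ih =>
    rw [pow_succ, M.a_mul, M.κ_c, M.a_c, Units.val_one, one_mul, ih, ← AddChar.map_add_eq_mul]
    congr 1; push_cast; ring

theorem a_pow {A : Γ} {i : ZMod N} (h : M.κ A * i = i) (m : ℕ) : M.a (A ^ m) i = M.a A i ^ m := by
  induction m with
  | zero => simp [M.a_one]
  | succ m ih => rw [pow_succ, M.a_mul, h, ih, pow_succ]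

theorem norm_a {A : Γ} {i : ZMod N} (h : M.κ A * i = i) : ‖M.a A i‖ = 1 := by
  obtain ⟨m, hm, hA⟩ := (isOfFinOrder_iff_pow_eq_one).mp (M.fin A)
  have := M.a_pow h m
  rw [hA, M.a_one] at this
  exact Complex.norm_eq_one_of_pow_eq_one this.symm hm.ne'

theorem ext {A B : Γ} (h : M.κ A = M.κ B) (h' : ∀ i, M.a A i = M.a B i) : A = B := by
  rw [← inv_mul_eq_one]
  apply M.faithful
  · rw [map_mul, map_inv, h, inv_mul_cancel]
  · intro i
    have := M.a_mul A (A⁻¹ * B) i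
    rw [mul_inv_cancel_left, map_mul, map_inv, h, inv_mul_cancel, Units.val_one, one_mul, h'] at this
    exact (mul_eq_left₀ (M.a_ne B i)).mp this.symm

/-- The power of `c` with exponent in `ZMod N`. -/
def cp (x : ZMod N) : Γ := M.c ^ x.val

@[simp] theorem κ_cp (x : ZMod N) : M.κ (M.cp x) = 1 := M.κ_c_pow _

@[simp] theorem a_cp (x i : ZMod N) : M.a (M.cp x) i = ZMod.stdAddChar (x * i) := by
  rw [cp, a_c_pow, ZMod.natCast_zmod_val]

theorem cp_add (x y : ZMod N) : M.cp (x + y) = M.cp x * M.cp y := by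
  apply M.ext
  · simp
  · intro i
    simp [M.a_mul, add_mul, AddChar.map_add_eq_mul]

@[simp] theorem cp_zero : M.cp 0 = 1 := by simp [cp]

/-- The trace of `A`. -/
noncomputable def χ (A : Γ) : ℂ := ∑ i : ZMod N with (M.κ A : ZMod N) * i = i, M.a A i

/-- `A` acts trivially on each of the lines it stabilizes. -/
def FixesLines (A : Γ) : Prop := ∀ i : ZMod N, M.κ A * i = i → M.a A i = 1

theorem exists_χ_eq_natCast (A : Γ) : ∃ t : ℕ, M.χ A = t := by
  obtain ⟨σ, h⟩ := M.perm A
  have := h 1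
  rw [pow_one] at this
  exact ⟨_, this⟩

theorem χ_mul_cp (A : Γ) (y : ZMod N) :
    M.χ (A * M.cp y) = ∑ i : ZMod N with (M.κ A : ZMod N) * i = i, M.a A i * ZMod.stdAddChar (y * i) := by
  rw [χ]
  have : M.κ (A * M.cp y) = M.κ A := by simp
  rw [this]
  exact Finset.sum_congr rfl fun i _ => by simp [M.a_mul]

theorem sum_χ_mul_cp (A : Γ) : ∑ y, M.χ (A * M.cp y) = N * M.a A 0 := by
  simp_rw [χ_mul_cp]
  rw [Finset.sum_comm]
  simp_rw [← Finset.mul_sum, AddChar.sum_mulShift _ (ZMod.isPrimitive_stdAddChar N)]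
  rw [Finset.sum_eq_single 0]
  · simp [mul_comm]
  · intro b _ hb; simp [hb]
  · simp

theorem sum_χ_mul_conj (A : Γ) :
    ∑ y, M.χ (A * M.cp y) * (starRingEnd ℂ) (M.χ (A * M.cp y)) =
      N * (Finset.univ.filter fun i : ZMod N => M.κ A * i = i).card := by
  simp_rw [χ_mul_cp, map_sum, Finset.sum_mul_sum]
  rw [Finset.sum_comm]
  have key : ∀ i ∈ Finset.univ.filter (fun i : ZMod N => M.κ A * i = i),
      ∑ y : ZMod N, ∑ j : ZMod N with (M.κ A : ZMod N) * j = j, M.a A i * ZMod.stdAddChar (y * i) *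
        (starRingEnd ℂ) (M.a A j * ZMod.stdAddChar (y * j)) = N := by
    intro i hi
    rw [Finset.sum_comm]
    have h1 : ∀ j y : ZMod N, M.a A i * ZMod.stdAddChar (y * i) *
        (starRingEnd ℂ) (M.a A j * ZMod.stdAddChar (y * j)) =
        (M.a A i * (starRingEnd ℂ) (M.a A j)) * ZMod.stdAddChar (y * (i - j)) := by
      intro j y
      rw [(starRingEnd ℂ).map_mul, mul_sub, sub_eq_add_neg, AddChar.map_add_eq_mul, AddChar.map_neg_eq_conj]
      ring
    simp_rw [h1, ← Finset.mul_sum, AddChar.sum_mulShift _ (ZMod.isPrimitive_stdAddChar N)]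
    rw [Finset.sum_eq_single i]
    · simp only [sub_self, if_true, ZMod.card]
      rw [Complex.mul_conj, Complex.normSq_eq_norm_sq, M.norm_a (Finset.mem_filter.mp hi).2]
      simp
    · intro b _ hb
      rw [if_neg (sub_ne_zero.mpr hb.symm)]; simp
    · intro h; exact absurd hi h
  rw [Finset.sum_congr rfl key]
  simp [mul_comm]

theorem norm_χ_le (A : Γ) :
    ‖M.χ A‖ ≤ (Finset.univ.filter fun i : ZMod N => M.κ A * i = i).card := by
  refine (norm_sum_le _ _).trans ?_
  rw [Finset.sum_congr rfl fun i hi => M.norm_a (Finset.mem_filter.mp hi).2]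
  simp

/-- The value is the average of nonnegative traces over the coset, so it is a nonnegative real; it
also has norm one. -/
theorem a_zero (A : Γ) : M.a A 0 = 1 := by
  choose t ht using fun y => M.exists_χ_eq_natCast (A * M.cp y)
  have h := M.sum_χ_mul_cp A
  simp_rw [ht] at h
  have hn : ‖M.a A 0‖ = 1 := M.norm_a (by simp)
  have hN : (N : ℂ) ≠ 0 := by exact_mod_cast NeZero.ne N
  have h1 : (((∑ y, t y : ℕ) : ℝ) / N : ℂ) = M.a A 0 := by
    rw [div_eq_iff hN, mul_comm (M.a A 0), ← h]; push_cast; rfl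
  rw [← h1] at hn ⊢
  have h2 : (((∑ y, t y : ℕ) : ℝ) / N : ℂ) = ((((∑ y, t y : ℕ) : ℝ) / N : ℝ) : ℂ) := by push_cast; rfl
  rw [h2, Complex.norm_of_nonneg (by positivity)] at hn
  rw [h2, hn, Complex.ofReal_one]

/-- With `t y` the trace and `F` the number of stabilized lines, `0 ≤ t y ≤ F`, `∑ t = N` and `∑ t²
= N * F`. Hence `∑ t (F - t) = 0` with nonnegative terms. -/
theorem χ_eq_zero_or_eq_card (A : Γ) : (∀ y, M.χ (A * M.cp y) = 0 ∨
    M.χ (A * M.cp y) = (Finset.univ.filter fun i : ZMod N => M.κ A * i = i).card) := by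
  choose t ht using fun y => M.exists_χ_eq_natCast (A * M.cp y)
  set F := (Finset.univ.filter fun i : ZMod N => M.κ A * i = i).card with hF
  have hle : ∀ y, t y ≤ F := by
    intro y
    have := M.norm_χ_le (A * M.cp y)
    rw [map_mul, M.κ_cp, mul_one, ht, Complex.norm_natCast] at this
    exact_mod_cast this
  have h1 : ∑ y, t y = N := by
    have h := M.sum_χ_mul_cp A
    simp_rw [ht] at h
    rw [M.a_zero, mul_one] at h
    exact_mod_cast h
  have h2 : ∑ y, t y * t y = N * F := by
    have h := M.sum_χ_mul_conj A
    simp_rw [ht, Complex.conj_natCast] at h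
    exact_mod_cast h
  have h3 : ∑ y, t y * (F - t y) = 0 := by
    have : ∑ y, t y * (F - t y) + ∑ y, t y * t y = (∑ y, t y) * F := by
      rw [← Finset.sum_add_distrib, Finset.sum_mul]
      refine Finset.sum_congr rfl fun y _ => ?_
      rw [← mul_add, Nat.sub_add_cancel (hle y)]
    rw [h1, h2] at this
    omega
  intro y
  have h4 := (Finset.sum_eq_zero_iff.mp h3) y (Finset.mem_univ _)
  rw [ht]
  rcases Nat.mul_eq_zero.mp h4 with h | h
  · left; exact_mod_cast h
  · right
    have := hle y
    have : t y = F := by omega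
    exact_mod_cast this

/-- Equality in the bound `Re a ≤ 1`, summed over the stabilized lines, forces every `a` to be `1`.
-/
theorem fixesLines_of_χ_ne_zero {A : Γ} (h : M.χ A ≠ 0) : M.FixesLines A := by
  have h1 := M.χ_eq_zero_or_eq_card A 0
  rw [cp_zero, mul_one] at h1
  have h2 := congrArg Complex.re (h1.resolve_left h)
  rw [χ, Complex.re_sum, Complex.natCast_re, Finset.card_eq_sum_ones, Nat.cast_sum] at h2
  have hle : ∀ i ∈ Finset.univ.filter (fun i : ZMod N => M.κ A * i = i),
      (M.a A i).re ≤ ((1 : ℕ) : ℝ) := fun i hi => by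
    rw [Nat.cast_one, ← M.norm_a (Finset.mem_filter.mp hi).2]; exact Complex.re_le_norm _
  intro i hi
  have h3 := (Finset.sum_eq_sum_iff_of_le hle).mp h2 i (by simpa using hi)
  have h4 := M.norm_a hi
  have h5 : (M.a A i).re = 1 := by simpa using h3
  have h6 := Complex.sq_norm (M.a A i)
  rw [h4, Complex.normSq_apply, h5] at h6
  apply Complex.ext
  · simpa using h5
  · have : (M.a A i).im * (M.a A i).im = 0 := by linarith
    simpa using this

theorem exists_fixesLines (A : Γ) : ∃ y, M.FixesLines (A * M.cp y) := by
  by_contra! hc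
  have h : ∀ y, M.χ (A * M.cp y) = 0 := fun y => by
    by_contra h0
    exact hc y (M.fixesLines_of_χ_ne_zero h0)
  have := M.sum_χ_mul_cp A
  simp_rw [h] at this
  simp only [M.a_zero, Finset.sum_const_zero, mul_one] at this
  exact NeZero.ne N (by exact_mod_cast this.symm)

theorem FixesLines.χ_eq {A : Γ} (h : M.FixesLines A) :
    M.χ A = (Finset.univ.filter fun i : ZMod N => M.κ A * i = i).card := by
  rw [χ, Finset.sum_congr rfl fun i hi => h i (Finset.mem_filter.mp hi).2]
  simp

variable {M}

/-- Line `0` is always stabilized, so the trace of `A` is positive and `σ` has a fixed point. It is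
fixed by `σ ^ m` too, so the trace of `A ^ m` is nonzero. -/
theorem FixesLines.pow {A : Γ} (h : M.FixesLines A) (m : ℕ) : M.FixesLines (A ^ m) := by
  apply fixesLines_of_χ_ne_zero
  obtain ⟨σ, hσ⟩ := M.perm A
  have h1 := hσ 1
  rw [pow_one, pow_one] at h1
  change M.χ A = _ at h1
  rw [h.χ_eq] at h1
  change ∑ i : ZMod N with (M.κ (A ^ m) : ZMod N) * i = i, M.a (A ^ m) i ≠ 0
  rw [hσ m]
  have h2 : 0 < (Function.fixedPoints σ).ncard := by
    have : 0 < (Finset.univ.filter fun i : ZMod N => M.κ A * i = i).card :=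
      Finset.card_pos.mpr ⟨0, by simp⟩
    have h1' : (Finset.univ.filter fun i : ZMod N => M.κ A * i = i).card =
      (Function.fixedPoints σ).ncard := by exact_mod_cast h1
    omega
  obtain ⟨x, hx⟩ := (Set.ncard_pos).mp h2
  have h3 : 0 < (Function.fixedPoints (σ ^ m)).ncard := by
    rw [Set.ncard_pos]
    refine ⟨x, ?_⟩
    have : Function.IsFixedPt σ x := hx
    have h4 := this.iterate m
    rw [← Equiv.Perm.coe_pow] at h4
    exact h4
  exact_mod_cast h3.ne'

theorem FixesLines.zpow {A : Γ} (h : M.FixesLines A) (m : ℤ) : M.FixesLines (A ^ m) := by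
  have : A ^ m ∈ Submonoid.powers A := by
    rw [(M.fin A).mem_powers_iff_mem_zpowers]
    exact ⟨m, rfl⟩
  obtain ⟨j, hj⟩ := this
  rw [← hj]
  exact h.pow j

theorem FixesLines.eq_one {A : Γ} (h : M.FixesLines A) (hκ : M.κ A = 1) : A = 1 :=
  M.faithful A hκ fun i => h i (by simp [hκ])

variable (M)

theorem exists_eq_cp {A : Γ} (hκ : M.κ A = 1) : ∃ x, A = M.cp x := by
  obtain ⟨y, hy⟩ := M.exists_fixesLines A
  have h := hy.eq_one (by simp [hκ])
  refine ⟨-y, ?_⟩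
  rw [eq_comm, ← mul_left_inj (M.cp y), h, ← cp_add]
  simp

theorem cp_mul (A : Γ) (x : ZMod N) : M.cp x * A = A * M.cp (M.κ A * x) := by
  apply M.ext
  · simp
  · intro i
    simp only [M.a_mul, a_cp, κ_cp, Units.val_one, one_mul]
    rw [mul_comm]; congr 2; ring

end MonomialCocycle

/-! ### Invariant vectors and a complement of `⟨c⟩`. -/

theorem IsOneModFour.zpow {N : ℕ} [NeZero N] {u : (ZMod N)ˣ} (hu : IsOneModFour u) (j : ℤ) :
    IsOneModFour (u ^ j) := by
  have : u ^ j ∈ Submonoid.powers u := mem_powers_iff_mem_zpowers.mpr ⟨j, rfl⟩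
  obtain ⟨m, hm⟩ := this
  rw [← hm]
  exact hu.pow m

namespace MonomialCocycle

variable {Γ : Type*} [Group Γ]

section

variable {N : ℕ} [NeZero N] (M : MonomialCocycle N Γ)

theorem exists_fixesLines_of_mem_range {k : (ZMod N)ˣ} (hk : k ∈ M.κ.range) :
    ∃ A, M.FixesLines A ∧ M.κ A = k := by
  obtain ⟨A, rfl⟩ := hk
  obtain ⟨y, hy⟩ := M.exists_fixesLines A
  exact ⟨_, hy, by simp⟩

/-- A subgroup of elements acting trivially on stabilized lines has an invariant vector with
no vanishing coordinate. -/
theorem exists_invariant_vector {H : Subgroup Γ} (hH : ∀ h ∈ H, M.FixesLines h) :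
    ∃ v : ZMod N → ℂ, (∀ i, v i ≠ 0) ∧ ∀ h ∈ H, ∀ i, M.a h i * v i = v (M.κ h * i) := by
  let s : Setoid (ZMod N) :=
    { r := fun i j => ∃ h ∈ H, (M.κ h : ZMod N) * i = j
      iseqv := by
        refine ⟨fun i => ⟨1, H.one_mem, by simp⟩, ?_, ?_⟩
        · rintro i j ⟨h, hh, rfl⟩
          exact ⟨h⁻¹, H.inv_mem hh, by simp⟩
        · rintro i j l ⟨h, hh, rfl⟩ ⟨h', hh', rfl⟩
          exact ⟨h' * h, H.mul_mem hh' hh, by simp [mul_assoc]⟩ }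
  let r : ZMod N → ZMod N := fun i => (Quotient.mk s i).out
  have hr : ∀ i, ∃ h ∈ H, (M.κ h : ZMod N) * r i = i := fun i => Quotient.mk_out (s := s) i
  have hr' : ∀ h ∈ H, ∀ i, r (M.κ h * i) = r i := by
    intro h hh i
    have : Quotient.mk s (M.κ h * i) = Quotient.mk s i := Quotient.sound (s.symm ⟨h, hh, rfl⟩)
    simp only [r, this]
  choose t htH ht using hr
  -- Each coordinate is transported from the orbit representative `r i`; two transports differ by a
  -- stabilizer of that line, which acts trivially.
  refine ⟨fun i => M.a (t i) (r i), fun i => M.a_ne _ _, fun h hh i => ?_⟩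
  set i' := (M.κ h : ZMod N) * i with hi'
  have h1 : M.a h i * M.a (t i) (r i) = M.a (h * t i) (r i) := by rw [M.a_mul, ht]
  have h2 : (M.κ ((t i')⁻¹ * (h * t i)) : ZMod N) * r i = r i := by
    rw [map_mul, map_mul, map_inv, Units.val_mul, Units.val_mul, mul_assoc, mul_assoc, ht, ← hi',
      Units.inv_mul_eq_iff_eq_mul]
    rw [← hr' h hh i, ← hi', ht]
  have h3 := hH _ (H.mul_mem (H.inv_mem (htH i')) (H.mul_mem hh (htH i))) _ h2
  have h4 := M.a_mul (t i') ((t i')⁻¹ * (h * t i)) (r i)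
  rw [mul_inv_cancel_left, h2, h3, mul_one] at h4
  change M.a h i * M.a (t i) (r i) = M.a (t i') (r i')
  rw [h1, h4, hr' h hh i]

end

variable {n : ℕ} (hn : 0 < n) (M : MonomialCocycle (2 ^ n) Γ)

include hn in
theorem FixesLines.a_two_pow_pred {M : MonomialCocycle (2 ^ n) Γ} {A : Γ} (hA : M.FixesLines A) :
    M.a A (2 ^ (n - 1)) = 1 :=
  hA _ (ZMod.unit_mul_two_pow_pred hn _)

-- Only the lines `0` and `2 ^ (n - 1)` are stabilized, and `a_zero` settles the first.
include hn in
theorem fixesLines_of_κ_eq_neg {A : Γ} {u : (ZMod (2 ^ n))ˣ} (hu : IsOneModFour u)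
    (hA : M.κ A = -u) (h : M.a A (2 ^ (n - 1)) = 1) : M.FixesLines A := by
  intro i hi
  rw [hA, Units.val_neg] at hi
  rcases hu.eq_of_neg_mul_eq hn hi with rfl | rfl
  · exact M.a_zero A
  · exact h

-- Write `g h = h g c ^ x` and `k = κ h`. Replacing `g` by `g c ^ y` changes `x` by a multiple of `k
-- - 1`, and `y` must be even to keep line `2 ^ (n - 1)` fixed. Divisibility of `x` by `k ^ 2 - 1`
-- is enough, as `k + 1` is even.
include hn in
theorem exists_commuting_fixesLines {g h : Γ} (hg : M.FixesLines g) (hh : M.FixesLines h)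
    (hgκ : M.κ g = -1) (hhκ : IsOneModFour (M.κ h)) :
    ∃ g', M.FixesLines g' ∧ M.κ g' = -1 ∧ g' * h = h * g' := by
  have hone : IsOneModFour (1 : (ZMod (2 ^ n))ˣ) := ⟨0, by simp⟩
  obtain ⟨x, hx⟩ := M.exists_eq_cp (A := (h * g)⁻¹ * (g * h)) (by
    rw [map_mul, map_inv, map_mul, map_mul, mul_comm (M.κ g), inv_mul_cancel])
  rw [inv_mul_eq_iff_eq_mul] at hx
  have hgg : g * g = 1 := by
    have := (hg.pow 2).eq_one (by rw [map_pow, hgκ]; simp)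
    rwa [pow_two] at this
  have hgh : M.FixesLines (g * h) := by
    apply M.fixesLines_of_κ_eq_neg hn hhκ
    · rw [map_mul, hgκ, neg_one_mul]
    · rw [M.a_mul, ZMod.unit_mul_two_pow_pred hn, hg.a_two_pow_pred hn, hh.a_two_pow_pred hn, one_mul]
  have hhg : h * g = g * h * M.cp (-x) := by
    rw [hx, mul_assoc, ← cp_add, add_neg_cancel, cp_zero, mul_one]
  have hsq : (g * h) ^ 2 = h ^ 2 * M.cp (M.κ h * -x) := by
    calc (g * h) ^ 2 = g * (h * g) * h := by rw [pow_two]; group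
      _ = (g * g) * h * (M.cp (-x) * h) := by rw [hhg]; group
      _ = _ := by rw [hgg, M.cp_mul, one_mul, ← mul_assoc, pow_two]
  -- If `k ^ 2 * i = i`, both `(g h) ^ 2 = h ^ 2 c ^ (-k x)` and `h ^ 2` fix line `i` pointwise, so
  -- `x * i = 0`.
  have hdvd : ((M.κ h : ZMod (2 ^ n)) ^ 2 - 1) ∣ x := by
    apply ZMod.dvd_of_forall_mul_eq_zero
    intro i hi
    have hi' : (M.κ (h ^ 2) : ZMod (2 ^ n)) * i = i := by
      rw [map_pow, Units.val_pow_eq_pow_val]; linear_combination hi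
    have h1 := (hgh.pow 2) i (by rw [hsq, map_mul, M.κ_cp, mul_one, hi'])
    rw [hsq, M.a_mul, M.κ_cp, Units.val_one, one_mul, (hh.pow 2) i hi', one_mul, M.a_cp,
      ← AddChar.map_zero_eq_one (ZMod.stdAddChar (N := 2 ^ n))] at h1
    have h2 := ZMod.injective_stdAddChar h1
    rw [mul_assoc, Units.mul_right_eq_zero] at h2
    linear_combination -h2
  obtain ⟨w, hw⟩ := hdvd
  set k : ZMod (2 ^ n) := (M.κ h : ZMod (2 ^ n)) with hk
  refine ⟨g * M.cp (-(k + 1) * w), ?_, by simp [hgκ], ?_⟩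
  · apply M.fixesLines_of_κ_eq_neg hn hone
    · simp [hgκ]
    · rw [M.a_mul, M.κ_cp, Units.val_one, one_mul, hg.a_two_pow_pred hn, one_mul, M.a_cp]
      have : -(k + 1) * w * 2 ^ (n - 1) = 0 := by
        linear_combination (-w) * ZMod.unit_mul_two_pow_pred hn (M.κ h) -
          w * ZMod.two_mul_two_pow_pred hn
      rw [this, AddChar.map_zero_eq_one]
  · rw [mul_assoc, M.cp_mul, ← mul_assoc, hx, mul_assoc, ← cp_add, mul_assoc, ← hk]
    congr 3
    rw [hw]; ring

include hn in
/-- There is a complement of `⟨c⟩` consisting of elements acting trivially on stabilized lines. -/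
theorem exists_complement : ∃ H : Subgroup Γ, (∀ h ∈ H, M.FixesLines h) ∧
    ∀ A, ∃ h ∈ H, M.κ h = M.κ A := by
  obtain ⟨k, hkK, hk⟩ := ZMod.exists_generator_up_to_sign hn M.κ.range
  by_cases hneg : (-1 : (ZMod (2 ^ n))ˣ) ∈ M.κ.range
  -- As `-1` is in the image, the sign of the generator can be chosen to make it `1` modulo `4`.
  · obtain ⟨k, hkK, hk4, hk⟩ : ∃ k ∈ M.κ.range, IsOneModFour k ∧
        ∀ x ∈ M.κ.range, ∃ j : ℤ, x = k ^ j ∨ x = -k ^ j := by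
      rcases ZMod.isOneModFour_or_neg hn k with h4 | h4
      · exact ⟨k, hkK, h4, hk⟩
      · refine ⟨-k, by simpa using mul_mem hneg hkK, h4, fun x hx => ?_⟩
        obtain ⟨j, hj⟩ := hk x hx
        refine ⟨j, ?_⟩
        rcases Int.even_or_odd j with he | ho
        · rwa [he.neg_zpow]
        · rw [ho.neg_zpow, neg_neg]; exact hj.symm
    obtain ⟨h, hh, rfl⟩ := M.exists_fixesLines_of_mem_range hkK
    obtain ⟨g₀, hg₀, hg₀κ⟩ := M.exists_fixesLines_of_mem_range hneg
    obtain ⟨g, hg, hgκ, hcomm⟩ := M.exists_commuting_fixesLines hn hg₀ hh hg₀κ hk4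
    have hgg : g * g = 1 := by
      have := (hg.pow 2).eq_one (by rw [map_pow, hgκ]; simp)
      rwa [pow_two] at this
    have hc : ∀ j : ℤ, h ^ j * g = g * h ^ j := fun j =>
      ((show Commute g h from hcomm).zpow_right j).symm
    have hginv : g⁻¹ = g := inv_eq_of_mul_eq_one_right hgg
    let H : Subgroup Γ :=
      { carrier := {x | ∃ j : ℤ, x = h ^ j ∨ x = g * h ^ j}
        one_mem' := ⟨0, by simp⟩
        mul_mem' := by
          rintro _ _ ⟨i, rfl | rfl⟩ ⟨j, rfl | rfl⟩ <;> refine ⟨i + j, ?_⟩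
          · left; rw [_root_.zpow_add]
          · right; rw [← mul_assoc, hc, mul_assoc, _root_.zpow_add]
          · right; rw [mul_assoc, _root_.zpow_add]
          · left
            rw [mul_assoc, ← mul_assoc (h ^ i), hc, mul_assoc g, ← mul_assoc g, hgg, one_mul,
              _root_.zpow_add]
        inv_mem' := by
          rintro _ ⟨i, rfl | rfl⟩ <;> refine ⟨-i, ?_⟩
          · left; rw [_root_.zpow_neg]
          · right; rw [_root_.mul_inv_rev, hginv, ← _root_.zpow_neg, hc] }
    refine ⟨H, ?_, fun A => ?_⟩
    · rintro _ ⟨j, rfl | rfl⟩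
      · exact hh.zpow j
      · apply M.fixesLines_of_κ_eq_neg hn (hk4.zpow j)
        · rw [map_mul, hgκ, neg_one_mul, map_zpow]
        · rw [M.a_mul, ZMod.unit_mul_two_pow_pred hn, hg.a_two_pow_pred hn,
            (hh.zpow j).a_two_pow_pred hn, one_mul]
    · obtain ⟨j, hj | hj⟩ := hk _ ⟨A, rfl⟩
      · exact ⟨h ^ j, ⟨j, Or.inl rfl⟩, by rw [map_zpow, hj]⟩
      · exact ⟨g * h ^ j, ⟨j, Or.inr rfl⟩, by rw [map_mul, map_zpow, hgκ, neg_one_mul, hj]⟩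
  · obtain ⟨h, hh, rfl⟩ := M.exists_fixesLines_of_mem_range hkK
    refine ⟨Subgroup.zpowers h, ?_, fun A => ?_⟩
    · rintro _ ⟨j, rfl⟩
      exact hh.zpow j
    · obtain ⟨j, hj | hj⟩ := hk _ ⟨A, rfl⟩
      · exact ⟨h ^ j, ⟨j, rfl⟩, by rw [map_zpow, hj]⟩
      -- An element over `-k ^ j` would put `-1` in the image.
      · refine absurd ⟨A * (h ^ j)⁻¹, ?_⟩ hneg
        rw [map_mul, map_inv, map_zpow, hj]
        simp

include hn in
/-- There is a vector with no vanishing coordinate whose orbit is its orbit under `⟨c⟩`. -/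
theorem exists_vector : ∃ v : ZMod (2 ^ n) → ℂ, (∀ i, v i ≠ 0) ∧
    ∀ A, ∃ x : ZMod (2 ^ n), ∀ i,
      M.a A i * v i = ZMod.stdAddChar (x * ((M.κ A : ZMod (2 ^ n)) * i)) * v (M.κ A * i) := by
  obtain ⟨H, hH, hH'⟩ := M.exists_complement hn
  obtain ⟨v, hv, hv'⟩ := M.exists_invariant_vector hH
  refine ⟨v, hv, fun A => ?_⟩
  obtain ⟨h, hh, hκ⟩ := hH' A
  obtain ⟨x, hx⟩ := M.exists_eq_cp (A := A * h⁻¹) (by rw [map_mul, map_inv, hκ, mul_inv_cancel])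
  rw [mul_inv_eq_iff_eq_mul] at hx
  refine ⟨x, fun i => ?_⟩
  rw [hx, M.a_mul, M.a_cp, mul_assoc, hv' h hh, M.κ.map_mul, M.κ_cp, one_mul]

end MonomialCocycle

/-! ### Eigenbasis of a maximal cycle and passage to matrices. -/

section MaximalCycle

variable {d : ℕ}

theorem Equiv.Perm.permMatrix_pow (σ : Equiv.Perm (Fin d)) (m : ℕ) :
    (σ ^ m).permMatrix ℂ = σ.permMatrix ℂ ^ m := by
  induction m with
  | zero => simp
  | succ m ih => rw [pow_succ', pow_succ, Matrix.permMatrix_mul, ih]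

theorem IsSimilarToPerm.pow {A : GL (Fin d) ℂ} {σ : Equiv.Perm (Fin d)} (h : IsSimilarToPerm A σ)
    (m : ℕ) : IsSimilarToPerm (A ^ m) (σ ^ m) := by
  obtain ⟨T, hT⟩ := h
  refine ⟨T, ?_⟩
  have : T⁻¹ * A ^ m * T = (T⁻¹ * A * T) ^ m := by
    have := conj_pow (a := T⁻¹) (b := A) (i := m)
    rw [inv_inv] at this
    exact this.symm
  rw [this, Units.val_pow_eq_pow_val, hT, Equiv.Perm.permMatrix_pow]

theorem IsSimilarToPerm.trace_eq {A : GL (Fin d) ℂ} {σ : Equiv.Perm (Fin d)}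
    (h : IsSimilarToPerm A σ) :
    (A : Matrix (Fin d) (Fin d) ℂ).trace = (Function.fixedPoints σ).ncard := by
  obtain ⟨T, hT⟩ := h
  rw [← Matrix.trace_permutation, ← hT, Units.val_mul, Matrix.trace_mul_comm, ← Units.val_mul]
  congr 2; group

theorem IsSimilarToPerm.isOfFinOrder {A : GL (Fin d) ℂ} {σ : Equiv.Perm (Fin d)}
    (h : IsSimilarToPerm A σ) : IsOfFinOrder A := by
  rw [isOfFinOrder_iff_pow_eq_one]
  refine ⟨orderOf σ, orderOf_pos σ, ?_⟩
  obtain ⟨T, hT⟩ := h.pow (orderOf σ)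
  rw [pow_orderOf_eq_one, Matrix.permMatrix_one] at hT
  have h1 : T⁻¹ * A ^ orderOf σ * T = 1 := Units.ext hT
  rwa [mul_assoc, inv_mul_eq_one, eq_comm, mul_eq_right] at h1

theorem IsSimilarToPerm.exists_semiconj {A : GL (Fin d) ℂ} {σ : Equiv.Perm (Fin d)}
    (h : IsSimilarToPerm A σ) : ∃ T : GL (Fin d) ℂ, ∀ u : Fin d → ℂ,
      (A : Matrix (Fin d) (Fin d) ℂ) *ᵥ ((T : Matrix (Fin d) (Fin d) ℂ) *ᵥ u) =
        (T : Matrix (Fin d) (Fin d) ℂ) *ᵥ (u ∘ σ) := by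
  obtain ⟨T, hT⟩ := h
  refine ⟨T, fun u => ?_⟩
  rw [← Matrix.permMatrix_mulVec, ← hT, Matrix.mulVec_mulVec, Matrix.mulVec_mulVec,
    ← Units.val_mul, ← Units.val_mul]
  congr 2; group

theorem GL_mulVec_injective (A : GL (Fin d) ℂ) :
    Function.Injective fun v : Fin d → ℂ => (A : Matrix (Fin d) (Fin d) ℂ) *ᵥ v :=
  Matrix.mulVec_injective_iff_isUnit.mpr A.isUnit

variable [NeZero d]

/-- The points of a full cycle are indexed by `ZMod d`. -/
theorem exists_zmod_index_of_isCycleOn {σ : Equiv.Perm (Fin d)} (h : σ.IsCycleOn Set.univ) :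
    ∃ p : Fin d → ZMod d, ∀ x, p (σ x) = p x + 1 := by
  have h' : σ.IsCycleOn (Finset.univ : Finset (Fin d)) := by simpa using h
  have h0 : (0 : Fin d) ∈ (Finset.univ : Finset (Fin d)) := Finset.mem_univ _
  choose m hm using fun x => h'.exists_pow_eq h0 (Finset.mem_univ x)
  refine ⟨fun x => m x, fun x => ?_⟩
  have h1 : (σ ^ m (σ x)) 0 = (σ ^ (m x + 1)) 0 := by
    rw [(hm (σ x)).2, pow_succ', Equiv.Perm.mul_apply, (hm x).2]
  rw [h'.pow_apply_eq_pow_apply h0, Finset.card_univ, Fintype.card_fin] at h1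
  have := (ZMod.natCast_eq_natCast_iff _ _ _).mpr h1
  push_cast at this
  exact this

/-- An eigenbasis of a maximal cycle. -/
theorem IsMaximalCycle.exists_basis {C : GL (Fin d) ℂ} (hC : IsMaximalCycle C) :
    ∃ e : Module.Basis (ZMod d) ℂ (Fin d → ℂ), ∀ i,
      (C : Matrix (Fin d) (Fin d) ℂ) *ᵥ e i = ZMod.stdAddChar i • e i := by
  obtain ⟨σ, hσ, hs⟩ := hC
  obtain ⟨p, hp⟩ := exists_zmod_index_of_isCycleOn hσ
  obtain ⟨T, hT⟩ := hs.exists_semiconj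
  -- The Fourier vectors along the cycle are eigenvectors of the shift.
  let u : ZMod d → Fin d → ℂ := fun i x => ZMod.stdAddChar (i * p x)
  have hu : ∀ i, u i ∘ σ = (ZMod.stdAddChar i : ℂ) • u i := by
    intro i
    ext x
    simp only [u, Function.comp_apply, hp, mul_add, mul_one, AddChar.map_add_eq_mul,
      Pi.smul_apply, smul_eq_mul]
    ring
  let f : ZMod d → Fin d → ℂ := fun i => (T : Matrix (Fin d) (Fin d) ℂ) *ᵥ u i
  have hf : ∀ i, (C : Matrix (Fin d) (Fin d) ℂ) *ᵥ f i = ZMod.stdAddChar i • f i := by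
    intro i
    simp only [f]
    rw [hT, hu, Matrix.mulVec_smul]
  have hf0 : ∀ i, f i ≠ 0 := by
    intro i h0
    have h1 : u i = 0 := GL_mulVec_injective T (by simpa [f] using h0)
    have h2 := congrFun h1 0
    exact (AddChar.val_isUnit ZMod.stdAddChar (i * p 0)).ne_zero h2
  have hli : LinearIndependent ℂ f := by
    apply Module.End.eigenvectors_linearIndependent' (Matrix.toLin' (C : Matrix (Fin d) (Fin d) ℂ))
      (fun i : ZMod d => (ZMod.stdAddChar i : ℂ)) ZMod.injective_stdAddChar f
    intro i
    refine ⟨?_, hf0 i⟩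
    rw [Module.End.mem_eigenspace_iff, Matrix.toLin'_apply, hf]
  refine ⟨basisOfLinearIndependentOfCardEqFinrank hli (by simp), fun i => ?_⟩
  rw [coe_basisOfLinearIndependentOfCardEqFinrank, hf]

/-- A normalizer of `⟨C⟩` permutes the eigenlines of `C`. -/
theorem exists_mulVec_basis_eq_smul {C A : GL (Fin d) ℂ}
    {e : Module.Basis (ZMod d) ℂ (Fin d → ℂ)}
    (he : ∀ i, (C : Matrix (Fin d) (Fin d) ℂ) *ᵥ e i = ZMod.stdAddChar i • e i)
    {m : ℕ} (hA : A⁻¹ * C * A = C ^ m) (i : ZMod d) :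
    ∃ z : ℂ, (A : Matrix (Fin d) (Fin d) ℂ) *ᵥ e i = z • e (m * i) := by
  have hm : ∀ m : ℕ, ((C ^ m : GL (Fin d) ℂ) : Matrix (Fin d) (Fin d) ℂ) *ᵥ e i =
      ZMod.stdAddChar (m * i : ZMod d) • e i := by
    intro m
    induction m with
    | zero => simp
    | succ m ih =>
      rw [pow_succ', Units.val_mul, ← Matrix.mulVec_mulVec, ih, Matrix.mulVec_smul, he, smul_smul,
        ← AddChar.map_add_eq_mul]
      congr 2; push_cast; ring
  set w := (A : Matrix (Fin d) (Fin d) ℂ) *ᵥ e i with hw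
  -- `C A = A C ^ m` makes `w` an eigenvector; the eigenvalues being distinct, it lies on a single
  -- line.
  have hCw : (C : Matrix (Fin d) (Fin d) ℂ) *ᵥ w = ZMod.stdAddChar (m * i : ZMod d) • w := by
    have h1 : C * A = A * C ^ m := by rw [← hA]; group
    rw [hw, Matrix.mulVec_mulVec, ← Units.val_mul, h1, Units.val_mul, ← Matrix.mulVec_mulVec, hm,
      Matrix.mulVec_smul]
  have hrepr : ∀ j, ZMod.stdAddChar j * e.repr w j = ZMod.stdAddChar (m * i : ZMod d) * e.repr w j := by
    intro j
    have h1 := congrArg (fun v => e.repr v j) hCw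
    simp only [map_smul, Finsupp.smul_apply, smul_eq_mul] at h1
    rw [← h1]
    conv_rhs => rw [← e.sum_repr w]
    rw [Matrix.mulVec_sum]
    simp_rw [Matrix.mulVec_smul, he, smul_smul]
    rw [e.repr_sum_self]
    ring
  refine ⟨e.repr w (m * i), ?_⟩
  apply e.repr.injective
  ext j
  rw [map_smul, e.repr_self, Finsupp.smul_single, smul_eq_mul, mul_one]
  by_cases hj : j = m * i
  · rw [hj, Finsupp.single_eq_same]
  · rw [Finsupp.single_eq_of_ne hj]
    by_contra h0
    exact hj (ZMod.injective_stdAddChar (mul_right_cancel₀ h0 (hrepr j)))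

theorem exists_monomialCocycle {G : Subgroup (GL (Fin d) ℂ)} (hG : IsPermutationLike G)
    {C : GL (Fin d) ℂ} (hCG : C ∈ G) (hN : ((Subgroup.zpowers C).subgroupOf G).Normal)
    {e : Module.Basis (ZMod d) ℂ (Fin d → ℂ)}
    (he : ∀ i, (C : Matrix (Fin d) (Fin d) ℂ) *ᵥ e i = ZMod.stdAddChar i • e i) :
    ∃ M : MonomialCocycle d G, ∀ (A : G) i,
      ((A : GL (Fin d) ℂ) : Matrix (Fin d) (Fin d) ℂ) *ᵥ e i = M.a A i • e (M.κ A * i) := by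
  have hfin : ∀ A ∈ G, IsOfFinOrder A := fun A hA => (hG A hA).choose_spec.isOfFinOrder
  have hex : ∀ A : G, ∃ k : ZMod d, ∀ i, ∃ z : ℂ,
      ((A : GL (Fin d) ℂ) : Matrix (Fin d) (Fin d) ℂ) *ᵥ e i = z • e (k * i) := by
    intro A
    have h1 := hN.conj_mem ⟨C, hCG⟩ (Subgroup.mem_subgroupOf.mpr (Subgroup.mem_zpowers C)) A⁻¹
    rw [Subgroup.mem_subgroupOf, inv_inv, ← (hfin C hCG).mem_powers_iff_mem_zpowers] at h1
    obtain ⟨m, hm⟩ := h1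
    exact ⟨m, exists_mulVec_basis_eq_smul he (by simpa using hm.symm)⟩
  have hne : ∀ (A : G) i, ((A : GL (Fin d) ℂ) : Matrix (Fin d) (Fin d) ℂ) *ᵥ e i ≠ 0 := by
    intro A i h0
    exact e.ne_zero i (GL_mulVec_injective (A : GL (Fin d) ℂ) (by simpa using h0))
  have huniq : ∀ (A : G) (k k' : ZMod d) (z z' : ℂ) (i : ZMod d),
      ((A : GL (Fin d) ℂ) : Matrix (Fin d) (Fin d) ℂ) *ᵥ e i = z • e k →
      ((A : GL (Fin d) ℂ) : Matrix (Fin d) (Fin d) ℂ) *ᵥ e i = z' • e k' → k = k' ∧ z = z' := by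
    intro A k k' z z' i h1 h2
    have hz : z ≠ 0 := by rintro rfl; exact hne A i (by rw [h1, zero_smul])
    have h3 := congrArg (fun v => e.repr v k) (h1.symm.trans h2)
    simp only [map_smul, e.repr_self, Finsupp.smul_apply, Finsupp.single_eq_same, smul_eq_mul,
      mul_one, Finsupp.single_apply] at h3
    by_cases hk : k' = k
    · rw [if_pos hk, mul_one] at h3; exact ⟨hk.symm, h3⟩
    · rw [if_neg hk, mul_zero] at h3; exact absurd h3 hz
  choose k a ha using hex
  have hmul : ∀ (A B : G) i, (((A * B : G) : GL (Fin d) ℂ) : Matrix (Fin d) (Fin d) ℂ) *ᵥ e i =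
      (a A (k B * i) * a B i) • e (k A * (k B * i)) := by
    intro A B i
    rw [Subgroup.coe_mul, Units.val_mul, ← Matrix.mulVec_mulVec, ha, Matrix.mulVec_smul, ha,
      smul_smul, mul_comm]
  -- Evaluating at `e 1` recovers the multiplier as an index; multipliers are units because `G` is a
  -- group.
  let κ₀ : G →* ZMod d :=
    { toFun := k
      map_one' := by
        have := (huniq 1 _ 1 _ 1 1 (ha 1 1) (by simp)).1
        simpa using this
      map_mul' := fun A B => by
        have := (huniq _ _ _ _ _ 1 (ha (A * B) 1) (hmul A B 1)).1
        simpa using this }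
  have hκ : ∀ A, ((κ₀.toHomUnits A : (ZMod d)ˣ) : ZMod d) = k A := fun A => rfl
  refine ⟨{ κ := κ₀.toHomUnits, a := a, a_mul := ?_, a_ne := ?_, faithful := ?_, fin := ?_,
            c := ⟨C, hCG⟩, κ_c := ?_, a_c := ?_, perm := ?_ }, fun A i => ha A i⟩
  · intro A B i
    rw [hκ]
    exact (huniq _ _ _ _ _ i (ha (A * B) i) (hmul A B i)).2
  · intro A i h0
    exact hne A i (by rw [ha, h0, zero_smul])
  · intro A h1 h2
    have h3 : k A = 1 := by rw [← hκ, h1, Units.val_one]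
    apply Subtype.ext
    apply Units.ext
    apply Matrix.toLin'.injective
    apply e.ext
    intro i
    rw [Matrix.toLin'_apply, Matrix.toLin'_apply, ha, h2, h3]
    simp
  · intro A
    exact Submonoid.isOfFinOrder_coe.mp (hfin A A.2)
  · apply Units.ext
    rw [hκ]
    have := (huniq ⟨C, hCG⟩ _ _ _ _ 1 (ha ⟨C, hCG⟩ 1) (he 1)).1
    simpa using this
  · intro i
    exact (huniq ⟨C, hCG⟩ _ _ _ _ i (ha ⟨C, hCG⟩ i) (he i)).2
  · intro A
    obtain ⟨σ, hσ⟩ := hG A A.2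
    refine ⟨σ, fun m => ?_⟩
    rw [← (hσ.pow m).trace_eq, ← Subgroup.coe_pow, ← Matrix.trace_toLin'_eq,
      LinearMap.trace_eq_matrix_trace ℂ e, Matrix.trace, Finset.sum_filter]
    refine Finset.sum_congr rfl fun i _ => ?_
    rw [Matrix.diag_apply, LinearMap.toMatrix_apply, Matrix.toLin'_apply, ha, map_smul,
      Finsupp.smul_apply, e.repr_self, Finsupp.single_apply, hκ]
    simp

/-- The translates under the diagonal characters of a vector with no vanishing coordinate are
linearly independent. -/
theorem linearIndependent_sum_stdAddChar_smul (e : Module.Basis (ZMod d) ℂ (Fin d → ℂ))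
    {v : ZMod d → ℂ} (hv : ∀ i, v i ≠ 0) :
    LinearIndependent ℂ fun x : ZMod d => ∑ i, (ZMod.stdAddChar (x * i) * v i) • e i := by
  rw [Fintype.linearIndependent_iff]
  intro l hl y
  simp_rw [Finset.smul_sum, smul_smul] at hl
  rw [Finset.sum_comm] at hl
  simp_rw [← Finset.sum_smul] at hl
  have h1 := Fintype.linearIndependent_iff.mp e.linearIndependent _ hl
  -- Twisting by the character at `-y` before summing over `i` isolates `l y`.
  have h2 : ∀ i : ZMod d, ∑ x, l x * ZMod.stdAddChar (i * (x - y)) = 0 := by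
    intro i
    have h3 : (∑ x, l x * ZMod.stdAddChar (x * i)) * v i = 0 := by
      rw [← h1 i, Finset.sum_mul]
      exact Finset.sum_congr rfl fun x _ => by ring
    have h4 := (mul_eq_zero.mp h3).resolve_right (hv i)
    rw [← zero_mul (ZMod.stdAddChar (-(y * i)) : ℂ), ← h4, Finset.sum_mul]
    refine Finset.sum_congr rfl fun x _ => ?_
    rw [mul_assoc, ← AddChar.map_add_eq_mul]
    congr 2; ring
  have h5 : ∑ i : ZMod d, ∑ x, l x * (ZMod.stdAddChar (i * (x - y)) : ℂ) = 0 :=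
    Finset.sum_eq_zero fun i _ => h2 i
  rw [Finset.sum_comm] at h5
  simp_rw [← Finset.mul_sum, AddChar.sum_mulShift _ (ZMod.isPrimitive_stdAddChar d)] at h5
  rw [Finset.sum_eq_single y] at h5
  · simpa [NeZero.ne d] using h5
  · intro b _ hb
    rw [if_neg (sub_ne_zero.mpr hb)]; simp
  · simp

/-- A matrix group permuting a basis is a permutation matrix group. -/
theorem isPermutationMatrixGroup_of_permutes {G : Subgroup (GL (Fin d) ℂ)}
    {b : ZMod d → Fin d → ℂ} (hb : LinearIndependent ℂ b)
    (h : ∀ A ∈ G, ∃ τ : Equiv.Perm (ZMod d), ∀ x,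
      (A : Matrix (Fin d) (Fin d) ℂ) *ᵥ b x = b (τ x)) :
    IsPermutationMatrixGroup G := by
  have q : Fin d ≃ ZMod d := Fintype.equivOfCardEq (by simp)
  let B : Matrix (Fin d) (Fin d) ℂ := Matrix.of fun i j => b (q j) i
  have hB : IsUnit B := by
    rw [← Matrix.linearIndependent_cols_iff_isUnit]
    exact hb.comp q q.injective
  obtain ⟨T, hT⟩ := hB
  refine ⟨T, fun A hA => ?_⟩
  obtain ⟨τ, hτ⟩ := h A hA
  let σ : Equiv.Perm (Fin d) := (q.trans τ).trans q.symm
  -- Right multiplication by a permutation matrix moves columns by the inverse permutation.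
  refine ⟨σ⁻¹, ?_⟩
  have key : (A : Matrix (Fin d) (Fin d) ℂ) * B = B * σ⁻¹.permMatrix ℂ := by
    rw [Equiv.Perm.permMatrix, PEquiv.mul_toMatrix_toPEquiv]
    ext i j
    have h1 := congrFun (hτ (q j)) i
    rw [Matrix.submatrix_apply]
    have h2 : B (id i) (σ j) = b (τ (q j)) i := by simp [B, σ]
    have h3 : (σ⁻¹).symm j = σ j := rfl
    rw [h3, h2, ← h1]
    rfl
  rw [mul_assoc, Units.val_mul, Units.val_mul, hT, key, ← hT, ← mul_assoc, ← Units.val_mul,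
    inv_mul_cancel, Units.val_one, one_mul]

end MaximalCycle

theorem theorem1 (n : ℕ) (hn : 0 < n) (G : Subgroup (GL (Fin (2 ^ n)) ℂ))
    (hG : IsPermutationLike G) (C : GL (Fin (2 ^ n)) ℂ) (hCG : C ∈ G) (hC : IsMaximalCycle C)
    (hN : ((Subgroup.zpowers C).subgroupOf G).Normal) :
    IsPermutationMatrixGroup G := by
  obtain ⟨e, he⟩ := hC.exists_basis
  obtain ⟨M, hM⟩ := exists_monomialCocycle hG hCG hN he
  obtain ⟨v, hv, hMv⟩ := M.exists_vector hn
  refine isPermutationMatrixGroup_of_permutes (linearIndependent_sum_stdAddChar_smul e hv) ?_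
  intro A hA
  obtain ⟨x₀, hx₀⟩ := hMv ⟨A, hA⟩
  -- From `A c ^ x = c ^ (κ⁻¹ x) A` and `A v = c ^ x₀ v`, the translate at `x` goes to the one at
  -- `κ⁻¹ x + x₀`.
  refine ⟨(Units.mulLeft (M.κ ⟨A, hA⟩)⁻¹).trans (Equiv.addRight x₀), fun x => ?_⟩
  rw [Matrix.mulVec_sum]
  refine Fintype.sum_equiv (Units.mulLeft (M.κ ⟨A, hA⟩)) _ _ fun i => ?_
  rw [Matrix.mulVec_smul, hM ⟨A, hA⟩, smul_smul, mul_assoc, mul_comm (v i), hx₀, ← mul_assoc,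
    ← AddChar.map_add_eq_mul]
  simp only [Units.mulLeft_apply, Equiv.trans_apply, Equiv.coe_addRight]
  congr 3
  rw [add_mul, mul_comm _ x, mul_assoc, Units.inv_mul_cancel_left]
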